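/- Let $n\ge 1$ and let $A=(a_{ij})\in\mathbb R^{n\times n}$ be a nonsingular M-matrix (that is, $a_{ij}\le 0$ for all $i\ne j$, and $A$ is invertible with entrywise nonnegative inverse) with unit diagonal, $a_{ii}=1$ for all $i$. Let $0<\omega\le 1$ and $0\le\gamma\le 1$. For a square matrix $B$ write $B=D_B-L_B-U_B$ with $D_B$ diagonal, $L_B$ strictly lower triangular and $U_B$ strictly upper triangular, and, when $D_B-\gamma L_B$ is invertible, let $$\mathscr L_{\gamma,\omega}(B)=(D_B-\gamma L_B)^{-1}\left[(1-\omega)D_B+(\omega-\gamma)L_B+\omega U_B\right]$$ be its AOR iteration matrix. Let $\alpha_{ij}$ $(1\le i,j\le n)$ be real numbers with $\alpha_{ii}=0$, $\alpha_{ij}\ge 0$ for $i\neq j$, and $\sum_{i\ne j}\alpha_{ij}a_{ij}\ne 0$. Put $Q_2=(-\alpha_{ij}a_{ij})$ and $A^{(2)}=(I+Q_2)A$, and let $\mathscr L_{\gamma,\omega}=\mathscr L_{\gamma,\omega}(A)$ and $\mathscr L^{(2)}_{\gamma,\omega}=\mathscr L_{\gamma,\omega}(A^{(2)})$. Suppose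 that $$(1-\alpha_{ij})a_{ij}-\sum_{k\ne i,j}\alpha_{ik}a_{ik}a_{kj}\le 0\qquad\text{for all } i\ne j .$$ Then $D_A-\gamma L_A$ and $D_{A^{(2)}}-\gamma L_{A^{(2)}}$ are invertible, so that both iteration matrices are defined, and their spectral radii satisfy $$\rho(\mathscr L^{(2)}_{\gamma,\omega})\le\rho(\mathscr L_{\gamma,\omega})<1 .$$ -/

import Mathlib

namespace AOR

noncomputable section

variable {n : ℕ}

/-- Nonnegative entries, at least one of them positive (written `B > 0` in matrix theory). -/
def IsSemipositive (B : Matrix (Fin n) (Fin n) ℝ) : Prop :=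
  (∀ i j, 0 ≤ B i j) ∧ ∃ i j, 0 < B i j

/-- All off-diagonal entries are nonpositive. -/
def IsZMatrix (B : Matrix (Fin n) (Fin n) ℝ) : Prop :=
  ∀ i j, i ≠ j → B i j ≤ 0

/-- Invertible, with `B⁻¹ > 0`. -/
def IsMonotone (B : Matrix (Fin n) (Fin n) ℝ) : Prop :=
  IsUnit B ∧ IsSemipositive B⁻¹

/-- A nonsingular M-matrix is a monotone Z-matrix. -/
def IsNonsingularMMatrix (B : Matrix (Fin n) (Fin n) ℝ) : Prop :=
  IsZMatrix B ∧ IsMonotone B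

/-- `D` in the decomposition `B = D - L - U`. -/
def diagPart (B : Matrix (Fin n) (Fin n) ℝ) : Matrix (Fin n) (Fin n) ℝ :=
  Matrix.diagonal B.diag

/-- The strictly lower triangular `L` in the decomposition `B = D - L - U`. -/
def lowerPart (B : Matrix (Fin n) (Fin n) ℝ) : Matrix (Fin n) (Fin n) ℝ :=
  Matrix.of fun i j => if j < i then -B i j else 0

/-- The strictly upper triangular `U` in the decomposition `B = D - L - U`. -/
def upperPart (B : Matrix (Fin n) (Fin n) ℝ) : Matrix (Fin n) (Fin n) ℝ :=
  Matrix.of fun i j => if i < j then -B i j else 0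

theorem eq_diagPart_sub_lowerPart_sub_upperPart (B : Matrix (Fin n) (Fin n) ℝ) :
    B = diagPart B - lowerPart B - upperPart B := by
  ext i j
  rcases lt_trichotomy i j with h | h | h
  · simp [diagPart, lowerPart, upperPart, h, h.ne, h.not_gt]
  · subst h
    simp [diagPart, lowerPart, upperPart]
  · simp [diagPart, lowerPart, upperPart, h, h.ne', h.not_gt]

/-- The matrix `D - γ L`, which the AOR method for `B` inverts. -/
def aorLeft (γ : ℝ) (B : Matrix (Fin n) (Fin n) ℝ) : Matrix (Fin n) (Fin n) ℝ :=
  diagPart B - γ • lowerPart B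

/-- The AOR iteration matrix `(D - γ L)⁻¹ [(1 - ω) D + (ω - γ) L + ω U]` of `B`. -/
def aorMatrix (γ ω : ℝ) (B : Matrix (Fin n) (Fin n) ℝ) : Matrix (Fin n) (Fin n) ℝ :=
  (aorLeft γ B)⁻¹ *
    ((1 - ω) • diagPart B + (ω - γ) • lowerPart B + ω • upperPart B)

/-- The spectral radius of a real matrix: the largest modulus of its complex eigenvalues. -/
def specRadius (B : Matrix (Fin n) (Fin n) ℝ) : ENNReal :=
  spectralRadius ℂ (B.map (fun x : ℝ => (x : ℂ)))

/-- `Q₂ = (-α_{ij} a_{ij})`. -/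
def Q₂ (α A : Matrix (Fin n) (Fin n) ℝ) : Matrix (Fin n) (Fin n) ℝ :=
  Matrix.of fun i j => -(α i j * A i j)

/-- The preconditioned matrix `A⁽²⁾ = P₂ A` with `P₂ = I + Q₂`. -/
def A₂ (α A : Matrix (Fin n) (Fin n) ℝ) : Matrix (Fin n) (Fin n) ℝ :=
  (1 + Q₂ α A) * A

end

end AOR

namespace AOR

open Matrix Filter Topology

variable {n : ℕ}

/-! Write `M = D - γL` and `T = M⁻¹(M - ωA)`, with `M'`, `T'` the same for `A' = (1 + Q)A`. All four
of `A`, `A'`, `M`, `M'` are Z-matrices sending one common positive vector to a positive vector, so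
they are inverse-positive; hence `T, T' ≥ 0` and `ρ(T) < 1`. A Perron vector of `T` may have zero
entries, so for `ρ(T) < r < 1` the vector `x` with `M(rx - Tx) = 1` replaces it: `x > 0`, `Tx ≤ rx`,
and `z = x - Tx` satisfies `Mz = ωAx ≥ 0`. The comparison `M'z ≤ (1 + Q)Mz = ωA'x`
(`aorLeft_one_add_mul_mulVec_le`) says `T'x ≤ Tx ≤ rx`, so `ρ(T') ≤ r` by Collatz–Wielandt
(`specRadius_le_of_mulVec_le`). -/

/-! ### Inverse-positivity of Z-matrices -/

/-- A Z-matrix that maps some positive vector to a positive vector is inverse-positive. -/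
theorem IsZMatrix.nonneg_of_mulVec_nonneg {B : Matrix (Fin n) (Fin n) ℝ} (hB : IsZMatrix B)
    {x : Fin n → ℝ} (hx : ∀ i, 0 < x i) (hBx : ∀ i, 0 < (B *ᵥ x) i)
    {y : Fin n → ℝ} (hy : 0 ≤ B *ᵥ y) : 0 ≤ y := by
  intro i₀
  by_contra! hneg
  have : Nonempty (Fin n) := ⟨i₀⟩
  obtain ⟨i, hi⟩ := Finite.exists_min fun i => y i / x i
  set t := y i / x i with ht
  have ht0 : t < 0 := (hi i₀).trans_lt (div_neg_of_neg_of_pos hneg (hx i₀))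
  have hz : ∀ j, t * x j ≤ y j := fun j => (le_div_iff₀ (hx j)).1 (hi j)
  have hzi : y i = t * x i := by rw [ht, div_mul_cancel₀ _ (hx i).ne']
  -- `y - t • x` is nonnegative and vanishes at `i`, so only off-diagonal entries of row `i`
  -- contribute.
  have h1 : (B *ᵥ y) i ≤ t * (B *ᵥ x) i := by
    simp only [mulVec, dotProduct, Finset.mul_sum]
    refine Finset.sum_le_sum fun j _ => ?_
    by_cases hij : i = j
    · subst hij
      rw [hzi]
      exact le_of_eq (by ring)
    · have := mul_le_mul_of_nonpos_left (hz j) (hB i j hij)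
      linarith
  have h2 := mul_neg_of_neg_of_pos ht0 (hBx i)
  have h3 := hy i
  simp only [Pi.zero_apply] at h3
  linarith

theorem isUnit_of_nonneg_of_mulVec_nonneg {B : Matrix (Fin n) (Fin n) ℝ}
    (hB : ∀ y, 0 ≤ B *ᵥ y → 0 ≤ y) : IsUnit B := by
  rw [← mulVec_injective_iff_isUnit]
  intro y z hyz
  have h1 := hB (y - z) (by rw [mulVec_sub, sub_nonneg]; exact hyz.ge)
  have h2 := hB (z - y) (by rw [mulVec_sub, sub_nonneg]; exact hyz.le)
  exact le_antisymm (sub_nonneg.1 h2) (sub_nonneg.1 h1)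

theorem mulVec_nonneg_of_nonneg {B : Matrix (Fin n) (Fin n) ℝ} (hB : ∀ i j, 0 ≤ B i j)
    {x : Fin n → ℝ} (hx : 0 ≤ x) : 0 ≤ B *ᵥ x :=
  fun i => Finset.sum_nonneg (s := Finset.univ) fun j _ => mul_nonneg (hB i j) (hx j)

theorem exists_mulVec_eq_of_isUnit {B : Matrix (Fin n) (Fin n) ℝ} (hB : IsUnit B)
    (y : Fin n → ℝ) : ∃ x, B *ᵥ x = y :=
  ⟨B⁻¹ *ᵥ y, by
    rw [mulVec_mulVec, mul_nonsing_inv _ ((isUnit_iff_isUnit_det B).1 hB), one_mulVec]⟩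

/-! ### Spectral radius of nonnegative matrices -/

/-- The Collatz–Wielandt upper bound for the spectral radius of a nonnegative matrix. -/
theorem specRadius_le_of_mulVec_le {B : Matrix (Fin n) (Fin n) ℝ} (hB : ∀ i j, 0 ≤ B i j)
    {x : Fin n → ℝ} (hx : ∀ i, 0 < x i) {r : ℝ} (hr : B *ᵥ x ≤ r • x) :
    specRadius B ≤ ENNReal.ofReal r := by
  refine iSup₂_le fun μ hμ => ?_
  rw [spectrum.mem_iff, isUnit_iff_isUnit_det, isUnit_iff_ne_zero, not_not,
    ← exists_mulVec_eq_zero_iff] at hμ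
  obtain ⟨u, hu0, hu⟩ := hμ
  obtain ⟨i₀, hi₀⟩ := Function.ne_iff.1 hu0
  have : Nonempty (Fin n) := ⟨i₀⟩
  -- The eigenvalue is bounded by reading `Bu = μu` in the row where `|u|/x` is largest.
  obtain ⟨i, hi⟩ := Finite.exists_max fun i => ‖u i‖ / x i
  set t := ‖u i‖ / x i with ht
  have hz : ∀ j, ‖u j‖ ≤ t * x j := fun j => (div_le_iff₀ (hx j)).1 (hi j)
  have hzi : ‖u i‖ = t * x i := by rw [ht, div_mul_cancel₀ _ (hx i).ne']
  have hui : 0 < ‖u i‖ := by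
    have h1 : 0 < t := (div_pos (norm_pos_iff.2 hi₀) (hx i₀)).trans_le (hi i₀)
    rw [hzi]
    exact mul_pos h1 (hx i)
  have ht0 : 0 ≤ t := div_nonneg (norm_nonneg _) (hx i).le
  have heq : μ * u i = ∑ j, (B i j : ℂ) * u j := by
    have h := congrFun hu i
    rw [sub_mulVec, Algebra.algebraMap_eq_smul_one, smul_mulVec, one_mulVec] at h
    simpa [mulVec, dotProduct, sub_eq_zero] using h
  have hle : ‖μ‖ * ‖u i‖ ≤ r * ‖u i‖ := calc
    ‖μ‖ * ‖u i‖ = ‖∑ j, (B i j : ℂ) * u j‖ := by rw [← heq, norm_mul]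
    _ ≤ ∑ j, ‖(B i j : ℂ) * u j‖ := norm_sum_le _ _
    _ ≤ ∑ j, t * (B i j * x j) := by
      refine Finset.sum_le_sum fun j _ => ?_
      rw [norm_mul, Complex.norm_real, Real.norm_of_nonneg (hB i j)]
      have := mul_le_mul_of_nonneg_left (hz j) (hB i j)
      linarith
    _ = t * (B *ᵥ x) i := by rw [← Finset.mul_sum]; rfl
    _ ≤ t * (r * x i) := mul_le_mul_of_nonneg_left (hr i) ht0
    _ = r * ‖u i‖ := by rw [hzi]; ring
  have hμr : ‖μ‖ ≤ r := le_of_mul_le_mul_right hle hui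
  rw [← enorm_eq_nnnorm, ← ofReal_norm]
  exact ENNReal.ofReal_le_ofReal hμr

-- Gelfand's formula: for `c` strictly between the spectral radius and `r`, eventually `‖B ^ k‖ ≤ c
-- ^ k`, and `(c / r) ^ k → 0`.
attribute [local instance] Matrix.linftyOpNormedRing Matrix.linftyOpNormedAlgebra in
theorem tendsto_pow_mulVec_div_pow {B : Matrix (Fin n) (Fin n) ℝ} {r : ℝ}
    (hr : specRadius B < ENNReal.ofReal r) (y : Fin n → ℝ) (i : Fin n) :
    Tendsto (fun k : ℕ => (B ^ k *ᵥ y) i / r ^ k) atTop (𝓝 0) := by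
  set C : Matrix (Fin n) (Fin n) ℂ := B.map (fun x : ℝ => (x : ℂ)) with hC
  obtain ⟨c, hc1, hc2⟩ := ENNReal.lt_iff_exists_nnreal_btwn.1 hr
  have hcr : (c : ℝ) < r := by
    rw [ENNReal.ofReal, ENNReal.coe_lt_coe] at hc2
    exact Real.lt_toNNReal_iff_coe_lt.1 hc2
  have hr0 : 0 < r := c.coe_nonneg.trans_lt hcr
  have hlim := (spectrum.pow_nnnorm_pow_one_div_tendsto_nhds_spectralRadius C).eventually
    (gt_mem_nhds hc1)
  have hpow : ∀ᶠ k : ℕ in atTop, ‖C ^ k‖ ≤ (c : ℝ) ^ k := by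
    filter_upwards [hlim, eventually_gt_atTop 0] with k hk hk0
    have hk0' : (0 : ℝ) < k := by exact_mod_cast hk0
    have h := ENNReal.rpow_le_rpow hk.le hk0'.le
    rw [← ENNReal.rpow_mul, one_div_mul_cancel hk0'.ne', ENNReal.rpow_one,
      ENNReal.rpow_natCast] at h
    exact_mod_cast h
  have hentry : ∀ k : ℕ, |(B ^ k *ᵥ y) i| ≤ ‖C ^ k‖ * ‖fun j => (y j : ℂ)‖ := by
    intro k
    have h1 : (C ^ k *ᵥ fun j => (y j : ℂ)) i = ((B ^ k *ᵥ y) i : ℝ) := by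
      have : C ^ k = (B ^ k).map (fun x : ℝ => (x : ℂ)) :=
        (map_pow (Complex.ofRealHom.mapMatrix) B k).symm
      rw [this]
      simp [mulVec, dotProduct]
    rw [← Real.norm_eq_abs, ← Complex.norm_real, ← h1]
    exact (norm_le_pi_norm _ i).trans (linfty_opNorm_mulVec _ _)
  refine squeeze_zero_norm' (a := fun k : ℕ => ((c : ℝ) / r) ^ k * ‖fun j => (y j : ℂ)‖) ?_ ?_
  · filter_upwards [hpow] with k hk
    rw [norm_div, Real.norm_eq_abs, Real.norm_of_nonneg (pow_nonneg hr0.le k), div_pow,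
      div_mul_eq_mul_div]
    gcongr
    exact (hentry k).trans (by gcongr)
  · have := (tendsto_pow_atTop_nhds_zero_of_lt_one (div_nonneg c.coe_nonneg hr0.le)
      ((div_lt_one hr0).2 hcr)).mul_const ‖fun j => (y j : ℂ)‖
    simpa using this

/-- Above the spectral radius of a nonnegative matrix, the resolvent is nonnegative. -/
theorem nonneg_of_specRadius_lt {B : Matrix (Fin n) (Fin n) ℝ} (hB : ∀ i j, 0 ≤ B i j)
    {r : ℝ} (hr : specRadius B < ENNReal.ofReal r) {y : Fin n → ℝ} (hy : B *ᵥ y ≤ r • y) :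
    0 ≤ y := by
  have hr0 : 0 < r := ENNReal.ofReal_pos.1 (pos_of_gt hr)
  -- Iterating the hypothesis puts `y` above `B ^ k y / r ^ k`, which tends to `0`.
  have hk : ∀ k : ℕ, B ^ k *ᵥ y ≤ r ^ k • y := by
    intro k
    induction k with
    | zero => simp
    | succ k ih =>
      have h1 := mulVec_nonneg_of_nonneg hB (sub_nonneg.2 ih)
      rw [mulVec_sub, sub_nonneg, mulVec_mulVec, ← pow_succ', mulVec_smul] at h1
      refine h1.trans ?_
      rw [pow_succ, mul_smul]
      exact smul_le_smul_of_nonneg_left hy (pow_nonneg hr0.le k)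
  intro i
  refine le_of_tendsto' (tendsto_pow_mulVec_div_pow hr y i) fun k => ?_
  rw [div_le_iff₀ (pow_pos hr0 k), mul_comm]
  exact hk k i

/-! ### The AOR splitting of a Z-matrix -/

/-- The remainder `M - B` of the splitting with `M = D - γ L`. -/
def aorRight (γ : ℝ) (B : Matrix (Fin n) (Fin n) ℝ) : Matrix (Fin n) (Fin n) ℝ :=
  (1 - γ) • lowerPart B + upperPart B

theorem diagPart_eq_add (B : Matrix (Fin n) (Fin n) ℝ) :
    diagPart B = B + upperPart B + lowerPart B :=
  sub_eq_iff_eq_add.1 (sub_eq_iff_eq_add.1 (eq_diagPart_sub_lowerPart_sub_upperPart B).symm)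

theorem aorLeft_eq_add (γ : ℝ) (B : Matrix (Fin n) (Fin n) ℝ) :
    aorLeft γ B = B + aorRight γ B := by
  rw [aorLeft, aorRight, diagPart_eq_add]
  module

theorem aorRight_nonneg {γ : ℝ} (hγ : γ ≤ 1) {B : Matrix (Fin n) (Fin n) ℝ} (hB : IsZMatrix B)
    (i j : Fin n) : 0 ≤ aorRight γ B i j := by
  simp only [aorRight, lowerPart, upperPart, Matrix.add_apply, Matrix.smul_apply, of_apply, smul_eq_mul]
  rcases lt_trichotomy i j with h | h | h
  · simpa [h, h.not_gt] using hB i j h.ne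
  · simp [h]
  · simpa [h, h.not_gt] using mul_nonneg (sub_nonneg.2 hγ) (neg_nonneg.2 (hB i j h.ne'))

theorem aorLeft_apply (γ : ℝ) (B : Matrix (Fin n) (Fin n) ℝ) (i j : Fin n) :
    aorLeft γ B i j = if j < i then γ * B i j else if i = j then B i i else 0 := by
  rcases lt_trichotomy i j with h | h | h
  · simp [aorLeft, diagPart, lowerPart, h.ne, h.not_gt]
  · simp [aorLeft, diagPart, lowerPart, h]
  · simp [aorLeft, diagPart, lowerPart, h, h.ne']

theorem isZMatrix_aorLeft {γ : ℝ} (hγ : 0 ≤ γ) {B : Matrix (Fin n) (Fin n) ℝ}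
    (hB : IsZMatrix B) : IsZMatrix (aorLeft γ B) := by
  intro i j hij
  rw [aorLeft_apply, if_neg hij]
  split_ifs
  · exact mul_nonpos_of_nonneg_of_nonpos hγ (hB i j hij)
  · exact le_rfl

/-- Since `M = B + N` with `N ≥ 0`, the vector `x` also has positive image under the Z-matrix `M`.
-/
theorem nonneg_of_aorLeft_mulVec_nonneg {γ : ℝ} (hγ₀ : 0 ≤ γ) (hγ₁ : γ ≤ 1)
    {B : Matrix (Fin n) (Fin n) ℝ} (hB : IsZMatrix B) {x : Fin n → ℝ} (hx : ∀ i, 0 < x i)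
    (hBx : ∀ i, 0 < (B *ᵥ x) i) {y : Fin n → ℝ} (hy : 0 ≤ aorLeft γ B *ᵥ y) : 0 ≤ y := by
  refine (isZMatrix_aorLeft hγ₀ hB).nonneg_of_mulVec_nonneg hx (fun i => ?_) hy
  rw [aorLeft_eq_add, add_mulVec]
  exact add_pos_of_pos_of_nonneg (hBx i)
    (mulVec_nonneg_of_nonneg (aorRight_nonneg hγ₁ hB) (fun i => (hx i).le) i)

theorem aorLeft_mulVec_aorMatrix_mulVec {γ : ℝ} (ω : ℝ) {B : Matrix (Fin n) (Fin n) ℝ}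
    (hM : IsUnit (aorLeft γ B)) (x : Fin n → ℝ) :
    aorLeft γ B *ᵥ (aorMatrix γ ω B *ᵥ x) = aorLeft γ B *ᵥ x - ω • (B *ᵥ x) := by
  have h : (1 - ω) • diagPart B + (ω - γ) • lowerPart B + ω • upperPart B
      = aorLeft γ B - ω • B := by
    rw [aorLeft, diagPart_eq_add]
    module
  rw [mulVec_mulVec, aorMatrix, h,
    mul_nonsing_inv_cancel_left _ _ ((isUnit_iff_isUnit_det _).1 hM), sub_mulVec, smul_mulVec]

/-- `M(Tx - (1 - ω)x) = ωNx ≥ 0`, and `M` is inverse-positive. This yields both `T ≥ 0` and, later,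
strict positivity of the test vector. -/
theorem smul_le_aorMatrix_mulVec {γ ω : ℝ} (hω : 0 ≤ ω) (hγ : γ ≤ 1)
    {B : Matrix (Fin n) (Fin n) ℝ} (hB : IsZMatrix B)
    (hM : ∀ y, 0 ≤ aorLeft γ B *ᵥ y → 0 ≤ y) {x : Fin n → ℝ} (hx : 0 ≤ x) :
    (1 - ω) • x ≤ aorMatrix γ ω B *ᵥ x := by
  rw [← sub_nonneg]
  refine hM _ ?_
  have h : aorLeft γ B *ᵥ (aorMatrix γ ω B *ᵥ x - (1 - ω) • x) = ω • (aorRight γ B *ᵥ x) := by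
    rw [mulVec_sub, aorLeft_mulVec_aorMatrix_mulVec ω (isUnit_of_nonneg_of_mulVec_nonneg hM),
      mulVec_smul, aorLeft_eq_add, add_mulVec]
    module
  rw [h]
  exact smul_nonneg hω (mulVec_nonneg_of_nonneg (aorRight_nonneg hγ hB) hx)

theorem aorMatrix_nonneg {γ ω : ℝ} (hω₀ : 0 ≤ ω) (hω₁ : ω ≤ 1) (hγ : γ ≤ 1)
    {B : Matrix (Fin n) (Fin n) ℝ} (hB : IsZMatrix B)
    (hM : ∀ y, 0 ≤ aorLeft γ B *ᵥ y → 0 ≤ y) (i j : Fin n) : 0 ≤ aorMatrix γ ω B i j := by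
  have hs : (0 : Fin n → ℝ) ≤ Pi.single j 1 := Pi.single_nonneg.2 zero_le_one
  have h := (smul_nonneg (sub_nonneg.2 hω₁) hs).trans (smul_le_aorMatrix_mulVec hω₀ hγ hB hM hs) i
  simpa using h

/-- A nonnegative vector with positive image under a Z-matrix is positive. -/
theorem IsZMatrix.pos_of_mulVec_pos {B : Matrix (Fin n) (Fin n) ℝ} (hB : IsZMatrix B)
    {x : Fin n → ℝ} (hx : 0 ≤ x) (hBx : ∀ i, 0 < (B *ᵥ x) i) (i : Fin n) : 0 < x i := by
  refine (hx i).lt_of_ne fun h0 => (hBx i).not_ge ?_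
  rw [mulVec, dotProduct]
  refine Finset.sum_nonpos fun j _ => ?_
  by_cases hij : i = j
  · subst hij
    rw [← h0]
    simp
  · exact mul_nonpos_of_nonpos_of_nonneg (hB i j hij) (hx j)

theorem IsNonsingularMMatrix.exists_pos_mulVec_pos {B : Matrix (Fin n) (Fin n) ℝ}
    (hB : IsNonsingularMMatrix B) :
    ∃ x : Fin n → ℝ, (∀ i, 0 < x i) ∧ ∀ i, 0 < (B *ᵥ x) i := by
  have h1 : B *ᵥ (B⁻¹ *ᵥ 1) = 1 := by
    rw [mulVec_mulVec, mul_nonsing_inv _ ((isUnit_iff_isUnit_det B).1 hB.2.1), one_mulVec]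
  have hpos : ∀ i, 0 < (B *ᵥ (B⁻¹ *ᵥ 1)) i := fun i => by simp [h1]
  exact ⟨B⁻¹ *ᵥ 1,
    hB.1.pos_of_mulVec_pos (mulVec_nonneg_of_nonneg hB.2.2.1 zero_le_one) hpos, hpos⟩

/-- `M(x - Tx) = ωBx > 0` forces `Tx < x` in every entry; the largest ratio `(Tx)ᵢ / xᵢ` is then a
Collatz–Wielandt bound below `1`. -/
theorem specRadius_aorMatrix_lt_one {γ ω : ℝ} (hω₀ : 0 < ω) (hω₁ : ω ≤ 1) (hγ₀ : 0 ≤ γ)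
    (hγ₁ : γ ≤ 1) {B : Matrix (Fin n) (Fin n) ℝ} (hB : IsZMatrix B) {x : Fin n → ℝ}
    (hx : ∀ i, 0 < x i) (hBx : ∀ i, 0 < (B *ᵥ x) i) : specRadius (aorMatrix γ ω B) < 1 := by
  have hM : ∀ y, 0 ≤ aorLeft γ B *ᵥ y → 0 ≤ y := fun y =>
    nonneg_of_aorLeft_mulVec_nonneg hγ₀ hγ₁ hB hx hBx
  have hlt : ∀ i, (aorMatrix γ ω B *ᵥ x) i < x i := by
    have heq : aorLeft γ B *ᵥ (x - aorMatrix γ ω B *ᵥ x) = ω • (B *ᵥ x) := by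
      rw [mulVec_sub, aorLeft_mulVec_aorMatrix_mulVec ω (isUnit_of_nonneg_of_mulVec_nonneg hM),
        sub_sub_cancel]
    have hpos : ∀ i, 0 < (aorLeft γ B *ᵥ (x - aorMatrix γ ω B *ᵥ x)) i := fun i => by
      rw [heq]
      exact mul_pos hω₀ (hBx i)
    intro i
    exact sub_pos.1 ((isZMatrix_aorLeft hγ₀ hB).pos_of_mulVec_pos
      (hM _ fun i => (hpos i).le) hpos i)
  obtain ⟨r, hr1, hr⟩ : ∃ r : ℝ, r < 1 ∧ aorMatrix γ ω B *ᵥ x ≤ r • x := by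
    rcases isEmpty_or_nonempty (Fin n) with hn | hn
    · exact ⟨0, zero_lt_one, fun i => isEmptyElim i⟩
    · obtain ⟨i, hi⟩ := Finite.exists_max fun i => (aorMatrix γ ω B *ᵥ x) i / x i
      exact ⟨(aorMatrix γ ω B *ᵥ x) i / x i, (div_lt_one (hx i)).2 (hlt i), fun j => (div_le_iff₀ (hx j)).1 (hi j)⟩
  refine (specRadius_le_of_mulVec_le (aorMatrix_nonneg hω₀.le hω₁ hγ₁ hB hM) hx hr).trans_lt ?_
  exact ENNReal.ofReal_lt_one.2 hr1

/-! ### Comparison under preconditioning -/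

theorem one_add_mul_apply (Q A : Matrix (Fin n) (Fin n) ℝ) (i j : Fin n) :
    ((1 + Q) * A) i j = A i j + ∑ k, Q i k * A k j := by
  rw [add_mul, one_mul, Matrix.add_apply, mul_apply]

/-- The left factor of the AOR splitting of `(1 + Q) A` is dominated by the product of the lower
triangular part of `1 + Q` with the left factor of the AOR splitting of `A`. -/
theorem aorLeft_one_add_mul_apply_le {γ : ℝ} (hγ₀ : 0 ≤ γ) (hγ₁ : γ ≤ 1)
    {A Q : Matrix (Fin n) (Fin n) ℝ} (hA : IsZMatrix A) (hA_diag : ∀ i, A i i = 1)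
    (hQ : ∀ i j, 0 ≤ Q i j) (hQ_diag : ∀ i, Q i i = 0) (i j : Fin n) :
    aorLeft γ ((1 + Q) * A) i j ≤ ((1 + -lowerPart Q) * aorLeft γ A) i j := by
  have hP : ∀ k, (-lowerPart Q) i k = if k < i then Q i k else 0 := fun k => by
    by_cases h : k < i <;> simp [lowerPart, h]
  rw [one_add_mul_apply, aorLeft_apply, one_add_mul_apply]
  simp only [hP, one_add_mul_apply]
  rcases lt_trichotomy i j with h | h | h
  · rw [if_neg h.not_gt, if_neg h.ne, aorLeft_apply, if_neg h.not_gt, if_neg h.ne, zero_add]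
    refine Finset.sum_nonneg fun k _ => ?_
    by_cases hk : k < i
    · simp [aorLeft_apply, (hk.trans h).not_gt, (hk.trans h).ne]
    · simp [hk]
  · subst h
    rw [if_neg (lt_irrefl i), if_pos rfl, aorLeft_apply, if_neg (lt_irrefl i), if_pos rfl]
    refine add_le_add_right (Finset.sum_le_sum fun k _ => ?_) _
    by_cases hk : k < i
    · simpa [aorLeft_apply, hk, hk.not_gt, hk.ne] using
        mul_nonpos_of_nonneg_of_nonpos (hQ i k) (hA k i hk.ne)
    · rcases eq_or_ne k i with rfl | hki
      · simp [hQ_diag]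
      · simpa [hk] using mul_nonpos_of_nonneg_of_nonpos (hQ i k) (hA k i hki)
  · rw [if_pos h, aorLeft_apply, if_pos h, mul_add, Finset.mul_sum]
    refine add_le_add_right (Finset.sum_le_sum fun k _ => ?_) _
    rw [mul_left_comm]
    -- Below the diagonal, terms with `k < i` reduce to `γ a_kj ≤ M_kj` (for `k = j` this is `γ ≤
    -- 1`); terms with `k ≥ i > j` are nonpositive on the left and absent on the right.
    by_cases hk : k < i
    · rw [if_pos hk, aorLeft_apply]
      refine mul_le_mul_of_nonneg_left ?_ (hQ i k)
      split_ifs with h1 h2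
      · exact le_rfl
      · subst h2
        simpa [hA_diag] using hγ₁
      · exact mul_nonpos_of_nonneg_of_nonpos hγ₀ (hA k j h2)
    · rw [if_neg hk, zero_mul]
      exact mul_nonpos_of_nonneg_of_nonpos (hQ i k) (mul_nonpos_of_nonneg_of_nonpos hγ₀
        (hA k j (h.trans_le (not_lt.1 hk)).ne'))

theorem aorLeft_one_add_mul_mulVec_le {γ : ℝ} (hγ₀ : 0 ≤ γ) (hγ₁ : γ ≤ 1)
    {A Q : Matrix (Fin n) (Fin n) ℝ} (hA : IsZMatrix A) (hA_diag : ∀ i, A i i = 1)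
    (hQ : ∀ i j, 0 ≤ Q i j) (hQ_diag : ∀ i, Q i i = 0) {z : Fin n → ℝ} (hz : 0 ≤ z)
    (hMz : 0 ≤ aorLeft γ A *ᵥ z) :
    aorLeft γ ((1 + Q) * A) *ᵥ z ≤ (1 + Q) *ᵥ (aorLeft γ A *ᵥ z) := by
  have h1 : 0 ≤ ((1 + -lowerPart Q) * aorLeft γ A - aorLeft γ ((1 + Q) * A)) *ᵥ z :=
    mulVec_nonneg_of_nonneg (fun i j => sub_nonneg.2
      (aorLeft_one_add_mul_apply_le hγ₀ hγ₁ hA hA_diag hQ hQ_diag i j)) hz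
  -- `lowerPart` carries a minus sign, so `Q + lowerPart Q` is the weakly upper part of `Q`.
  have h2 : 0 ≤ (Q + lowerPart Q) *ᵥ (aorLeft γ A *ᵥ z) := by
    refine mulVec_nonneg_of_nonneg (fun i j => ?_) hMz
    by_cases h : j < i
    · simp [lowerPart, h]
    · simpa [lowerPart, h] using hQ i j
  have h3 := add_nonneg h1 h2
  rw [sub_mulVec, ← mulVec_mulVec, sub_add_eq_add_sub, ← add_mulVec, sub_nonneg] at h3
  rwa [show 1 + -lowerPart Q + (Q + lowerPart Q) = 1 + Q by abel] at h3

/-- Preconditioning by `1 + Q` with `Q` nonnegative does not increase the spectral radius of the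
AOR iteration matrix, as long as the preconditioned matrix remains a Z-matrix. -/
theorem specRadius_aorMatrix_one_add_mul_le {γ ω : ℝ} (hω₀ : 0 < ω) (hω₁ : ω ≤ 1) (hγ₀ : 0 ≤ γ)
    (hγ₁ : γ ≤ 1) {A Q : Matrix (Fin n) (Fin n) ℝ} (hA : IsZMatrix A)
    (hA_diag : ∀ i, A i i = 1) (hQ : ∀ i j, 0 ≤ Q i j) (hQ_diag : ∀ i, Q i i = 0)
    (hQA : IsZMatrix ((1 + Q) * A)) (hM : ∀ y, 0 ≤ aorLeft γ A *ᵥ y → 0 ≤ y)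
    (hM' : ∀ y, 0 ≤ aorLeft γ ((1 + Q) * A) *ᵥ y → 0 ≤ y)
    (hlt : specRadius (aorMatrix γ ω A) < 1) :
    specRadius (aorMatrix γ ω ((1 + Q) * A)) ≤ specRadius (aorMatrix γ ω A) := by
  by_contra! hcon
  obtain ⟨c, hc, hc'⟩ := ENNReal.lt_iff_exists_nnreal_btwn.1 (lt_min hlt hcon)
  obtain ⟨hc1, hc2⟩ := lt_min_iff.1 hc'
  rw [← ENNReal.ofReal_coe_nnreal] at hc hc1 hc2
  set r : ℝ := (c : ℝ)
  have hr1 : r < 1 := ENNReal.ofReal_lt_one.1 hc1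
  set T := aorMatrix γ ω A
  have hU := isUnit_of_nonneg_of_mulVec_nonneg hM
  have hU' := isUnit_of_nonneg_of_mulVec_nonneg hM'
  have hT : ∀ i j, 0 ≤ T i j := aorMatrix_nonneg hω₀.le hω₁ hγ₁ hA hM
  have hres : ∀ y : Fin n → ℝ, (r • (1 : Matrix (Fin n) (Fin n) ℝ) - T) *ᵥ y = r • y - T *ᵥ y :=
    fun y => by rw [sub_mulVec, smul_mulVec, one_mulVec]
  -- The right-hand side `v = M⁻¹1` makes `v` positive and also gives `M(rx - Tx) = 1`.
  obtain ⟨v, hv⟩ := exists_mulVec_eq_of_isUnit hU 1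
  have hv0 : ∀ i, 0 < v i := (isZMatrix_aorLeft hγ₀ hA).pos_of_mulVec_pos
    (hM v (by rw [hv]; exact zero_le_one)) fun i => by simp [hv]
  obtain ⟨x, hx⟩ := exists_mulVec_eq_of_isUnit (B := r • (1 : Matrix (Fin n) (Fin n) ℝ) - T)
    (isUnit_of_nonneg_of_mulVec_nonneg fun y hy =>
      nonneg_of_specRadius_lt hT hc (sub_nonneg.1 (hres y ▸ hy))) v
  rw [hres] at hx
  have hTx : T *ᵥ x ≤ r • x := sub_nonneg.1 (hx ▸ fun i => (hv0 i).le)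
  have hx0 : 0 ≤ x := nonneg_of_specRadius_lt hT hc hTx
  -- From `Tx ≥ (1 - ω)x` and `rx - Tx = v > 0`; this gives both `x > 0` and `r - 1 + ω > 0`.
  have hprod : ∀ i, 0 < (r - 1 + ω) * x i := fun i => by
    have h1 := smul_le_aorMatrix_mulVec hω₀.le hγ₁ hA hM hx0 i
    have h2 := congrFun hx i
    simp only [Pi.smul_apply, Pi.sub_apply, smul_eq_mul] at h1 h2
    linarith [hv0 i]
  have hxpos : ∀ i, 0 < x i := fun i =>
    (hx0 i).lt_of_ne fun h => (hprod i).ne' (by rw [← h]; simp)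
  have hMTx : aorLeft γ A *ᵥ (T *ᵥ x) = r • (aorLeft γ A *ᵥ x) - 1 := by
    rw [← hv, ← hx, mulVec_sub, mulVec_smul, sub_sub_cancel]
  have hωA : aorLeft γ A *ᵥ (T *ᵥ x) = aorLeft γ A *ᵥ x - ω • (A *ᵥ x) :=
    aorLeft_mulVec_aorMatrix_mulVec ω hU x
  have hMx : 0 ≤ aorLeft γ A *ᵥ x := fun i => by
    have h1 : aorLeft γ A *ᵥ x = A *ᵥ x + aorRight γ A *ᵥ x := by
      rw [← add_mulVec, ← aorLeft_eq_add]
    have h2 := congrFun (hMTx.symm.trans hωA) i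
    have h3 := congrFun h1 i
    have h4 := mulVec_nonneg_of_nonneg (aorRight_nonneg hγ₁ hA) hx0 i
    simp only [Pi.smul_apply, Pi.sub_apply, Pi.add_apply, Pi.one_apply, Pi.zero_apply,
      smul_eq_mul] at h2 h3 h4 ⊢
    refine nonneg_of_mul_nonneg_right ?_ (pos_of_mul_pos_left (hprod i) (hx0 i))
    have h5 := mul_nonneg hω₀.le h4
    have h6 : (r - 1 + ω) * (aorLeft γ A *ᵥ x) i = 1 + ω * (aorRight γ A *ᵥ x) i := by
      linear_combination h2 + ω * h3
    linarith
  have hMz : aorLeft γ A *ᵥ (x - T *ᵥ x) = ω • (A *ᵥ x) := by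
    rw [mulVec_sub, hωA, sub_sub_cancel]
  have hMz0 : 0 ≤ aorLeft γ A *ᵥ (x - T *ᵥ x) := by
    have h : aorLeft γ A *ᵥ (x - T *ᵥ x) = (1 - r) • (aorLeft γ A *ᵥ x) + 1 := by
      rw [mulVec_sub, hMTx]
      module
    rw [h]
    exact add_nonneg (smul_nonneg (sub_nonneg.2 hr1.le) hMx) zero_le_one
  have hcomp := aorLeft_one_add_mul_mulVec_le hγ₀ hγ₁ hA hA_diag hQ hQ_diag (hM _ hMz0) hMz0
  -- `M'(Tx - T'x) = ωA'x - M'z`, which is nonnegative by `hcomp`.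
  have hle : aorMatrix γ ω ((1 + Q) * A) *ᵥ x ≤ T *ᵥ x := by
    rw [← sub_nonneg]
    refine hM' _ ?_
    rw [hMz, mulVec_smul, mulVec_mulVec, mulVec_sub] at hcomp
    rw [mulVec_sub, aorLeft_mulVec_aorMatrix_mulVec ω hU']
    rw [← sub_nonneg] at hcomp
    convert hcomp using 1
    abel
  exact hc2.not_ge (specRadius_le_of_mulVec_le (aorMatrix_nonneg hω₀.le hω₁ hγ₁ hQA hM') hxpos
    (hle.trans hTx))

/-- The left side of `hineq` is exactly the `(i, j)` entry of `A₂`: the term `k = i` vanishes as `α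
i i = 0`, and `k = j` gives `α i j * A i j` as `A j j = 1`. -/
theorem isZMatrix_A₂ {A α : Matrix (Fin n) (Fin n) ℝ} (hA_diag : ∀ i, A i i = 1)
    (hα_diag : ∀ i, α i i = 0)
    (hineq : ∀ i j, i ≠ j →
      (1 - α i j) * A i j
        - ∑ k ∈ Finset.univ.filter (fun k => k ≠ i ∧ k ≠ j), α i k * A i k * A k j ≤ 0) :
    IsZMatrix (A₂ α A) := by
  intro i j hij
  refine le_of_eq_of_le ?_ (hineq i j hij)
  have h1 : ∑ k ∈ Finset.univ.filter (fun k => k ≠ i ∧ k ≠ j), α i k * A i k * A k j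
      = ∑ k, α i k * A i k * A k j - α i j * A i j := by
    have h2 : Finset.univ.filter (fun k => k ≠ i ∧ k ≠ j) = (Finset.univ.erase j).erase i := by
      ext k
      simp
    rw [h2, Finset.sum_erase _ (by simp [hα_diag]), Finset.sum_erase_eq_sub (Finset.mem_univ j),
      hA_diag, mul_one]
  rw [h1, A₂, one_add_mul_apply]
  simp only [Q₂, of_apply, neg_mul, Finset.sum_neg_distrib]
  ring

end AOR

theorem theorem3p6 {n : ℕ} (A α : Matrix (Fin n) (Fin n) ℝ) (γ ω : ℝ)
    (hω₀ : 0 < ω) (hω₁ : ω ≤ 1) (hγ₀ : 0 ≤ γ) (hγ₁ : γ ≤ 1)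
    (hA : AOR.IsNonsingularMMatrix A) (hA_diag : ∀ i, A i i = 1)
    (hα_diag : ∀ i, α i i = 0) (hα : ∀ i j, i ≠ j → 0 ≤ α i j)
    (hQ : ∑ i, ∑ j ∈ Finset.univ.filter (fun j => j ≠ i), α i j * A i j ≠ 0)
    (hineq : ∀ i j, i ≠ j →
      (1 - α i j) * A i j
        - ∑ k ∈ Finset.univ.filter (fun k => k ≠ i ∧ k ≠ j), α i k * A i k * A k j ≤ 0) :
    IsUnit (AOR.aorLeft γ A) ∧ IsUnit (AOR.aorLeft γ (AOR.A₂ α A)) ∧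
      AOR.specRadius (AOR.aorMatrix γ ω (AOR.A₂ α A)) ≤ AOR.specRadius (AOR.aorMatrix γ ω A) ∧
      AOR.specRadius (AOR.aorMatrix γ ω A) < 1 := by
  have hQ₂ : ∀ i j, 0 ≤ AOR.Q₂ α A i j := fun i j => by
    rcases eq_or_ne i j with rfl | hij
    · simp [AOR.Q₂, hα_diag]
    · simpa [AOR.Q₂] using mul_nonpos_of_nonneg_of_nonpos (hα i j hij) (hA.1 i j hij)
  have hQ₂_diag : ∀ i, AOR.Q₂ α A i i = 0 := fun i => by simp [AOR.Q₂, hα_diag]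
  have hZ : AOR.IsZMatrix (AOR.A₂ α A) := AOR.isZMatrix_A₂ hA_diag hα_diag hineq
  obtain ⟨x, hx, hAx⟩ := hA.exists_pos_mulVec_pos
  -- The same `x` serves for `A₂`, because `(1 + Q₂)(Ax) ≥ Ax > 0`.
  have hA₂x : ∀ i, 0 < ((AOR.A₂ α A).mulVec x) i := fun i => by
    rw [AOR.A₂, ← Matrix.mulVec_mulVec, Matrix.add_mulVec, Matrix.one_mulVec]
    exact add_pos_of_pos_of_nonneg (hAx i)
      (AOR.mulVec_nonneg_of_nonneg hQ₂ (fun i => (hAx i).le) i)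
  have hM : ∀ y, 0 ≤ (AOR.aorLeft γ A).mulVec y → 0 ≤ y := fun y =>
    AOR.nonneg_of_aorLeft_mulVec_nonneg hγ₀ hγ₁ hA.1 hx hAx
  have hM₂ : ∀ y, 0 ≤ (AOR.aorLeft γ (AOR.A₂ α A)).mulVec y → 0 ≤ y := fun y =>
    AOR.nonneg_of_aorLeft_mulVec_nonneg hγ₀ hγ₁ hZ hx hA₂x
  have hlt := AOR.specRadius_aorMatrix_lt_one hω₀ hω₁ hγ₀ hγ₁ hA.1 hx hAx
  exact ⟨AOR.isUnit_of_nonneg_of_mulVec_nonneg hM, AOR.isUnit_of_nonneg_of_mulVec_nonneg hM₂,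
    AOR.specRadius_aorMatrix_one_add_mul_le hω₀ hω₁ hγ₀ hγ₁ hA.1 hA_diag hQ₂ hQ₂_diag hZ hM hM₂
      hlt, hlt⟩
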